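/- **Setting.** Let $E$ be a real Banach space that is uniformly smooth and uniformly convex, with dual $E^*$, and let $J:E\to E^*$ be the normalized duality mapping, $\langle x,Jx\rangle=\|x\|\,\|Jx\|$, $\|Jx\|=\|x\|$ (a single-valued bijection in this setting). Put $\phi(x,y)=\|x\|^2-2\langle x,Jy\rangle+\|y\|^2$; for $K\subset E$ and $x\in E$ let $\Pi_Kx$ denote the point of $K$ at which $\phi(\cdot,x)$ attains its minimum over $K$. Let $C\subset E$ be nonempty, closed and convex. *Equilibrium problem.* Let $F:C\times C\to\mathbb R$ satisfy: (A1) $F(x,x)=0$ for all $x\in C$; (A2) $F(x,y)+F(y,x)\le 0$ for all $x,y\in C$; (A3) $\limsup_{t\to0^+}F(tz+(1-t)x,y)\le F(x,y)$ for all $x,y,z\in C$; (A4) $F(x,\cdot)$ is convex and lower semicontinuous on $C$ for each $x\in C$. Let $EP(F)=\{x\in C: F(x,y)\ge0\ \ \forall y\in C\}$. *Multivalued mappings.* For a map $T$ from $C$ to the nonempty subsets of $C$, let $F(T)=\{x\in C:x\in Tx\}$ and $P_Tx=\{y\in Tx:\|x-y\|=\operatorname{dist}(x,Tx)\}$. Such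 a map $T$ is called *closed* if $w_n\in C$, $w_n\to w$ and $\operatorname{dist}(w_n,Tw_n)\to0$ imply $w\in Tw$. It is called *relatively quasi-nonexpansive* if $F(T)\ne\emptyset$ and $\Phi(Tp,Tx)\le\phi(p,x)$ for all $p\in F(T)$, $x\in C$, where $$\Phi(A,B)=\max\Big\{\sup_{q\in B}\inf_{y\in A}\phi(y,q),\ \sup_{y\in A}\inf_{q\in B}\phi(y,q)\Big\}.$$ **Theorem 3.1.** Let $T_i$ ($i\ge1$) be maps from $C$ to the nonempty subsets of $C$ such that, for each $i$, $P_{T_i}$ has nonempty values and is closed and relatively quasi-nonexpansive, and assume $\mathcal F=\bigcap_{i\ge1}F(T_i)\cap EP(F)\neq\emptyset$. Let $a_{n,i}\ge0$ ($n,i\ge0$) with $\sum_{i=0}^\infty a_{n,i}=1$ for each $n$ and $\liminf_{n}a_{n,0}a_{n,i}>0$ for each $i\ge1$, and let $r_n>0$ with $\liminf_n r_n>0$. Let $x_0\in C$, $C_0=C$, and let $(x_n)$ be generated by $$\begin{cases}y_n=J^{-1}\big(a_{n,0}Jx_n+\sum_{i=1}^\infty a_{n,i}Jz_{n,i}\big),\quad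 z_{n,i}\in P_{T_i}x_n,\\ u_n\in C:\ F(u_n,y)+\frac1{r_n}\langle y-u_n,Ju_n-Jy_n\rangle\ge0\quad\forall y\in C,\\ C_{n+1}=\{z\in C_n:\phi(z,u_n)\le\phi(z,x_n)\},\\ x_{n+1}=\Pi_{C_{n+1}}x_0,\qquad n\ge0.\end{cases}$$ Then $\phi(\cdot,x_0)$ has a unique minimizer $\Pi_{\mathcal F}x_0$ on $\mathcal F$, and $x_n$ converges strongly to $\Pi_{\mathcal F}x_0$. -/

import Mathlib

open Filter Topology

namespace ShrinkingProjection

noncomputable section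

variable {E : Type*} [NormedAddCommGroup E] [NormedSpace ℝ E]

/-- Uniform smoothness: the limit of `(‖x + t y‖ - ‖x‖) / t` as `t → 0` exists, uniformly for
`x`, `y` in the unit sphere. -/
def UniformlySmooth (E : Type*) [NormedAddCommGroup E] [NormedSpace ℝ E] : Prop :=
  ∃ L : E → E → ℝ, ∀ ε > 0, ∃ δ > 0, ∀ x y : E, ‖x‖ = 1 → ‖y‖ = 1 →
    ∀ t : ℝ, t ≠ 0 → |t| < δ → |(‖x + t • y‖ - ‖x‖) / t - L x y| < ε

/-- The (set-valued) normalized duality mapping from `E` to subsets of its dual. -/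
def dualitySet (x : E) : Set (StrongDual ℝ E) :=
  {f | f x = ‖x‖ * ‖f‖ ∧ ‖x‖ = ‖f‖}

theorem dualitySet_nonempty (x : E) : (dualitySet x).Nonempty := by
  by_cases hx : x = 0
  · exact ⟨0, by simp [dualitySet, hx]⟩
  · obtain ⟨g, hg, hgx⟩ := exists_dual_vector ℝ x (norm_ne_zero_iff.mpr hx)
    have hgx' : g x = ‖x‖ := by simpa using hgx
    refine ⟨‖x‖ • g, ?_, ?_⟩ <;> simp [norm_smul, hg, hgx']

/-- The duality mapping as a function `E → E*`; when `E` is smooth, `dualitySet x` is the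
singleton of this functional. -/
def dualityMap (x : E) : StrongDual ℝ E := (dualitySet_nonempty x).choose

/-- The inverse of the duality mapping (which is a bijection `E → E*` when `E` is uniformly smooth,
uniformly convex and complete). -/
def dualityInv (f : StrongDual ℝ E) : E := Function.invFun dualityMap f

/-- `φ(x, y) = ‖x‖² - 2⟨x, J y⟩ + ‖y‖²`. -/
def phi (x y : E) : ℝ := ‖x‖ ^ 2 - 2 * dualityMap y x + ‖y‖ ^ 2

/-- `p` is a minimizer of `φ(·, x)` over `K`. -/
def IsGenProj (K : Set E) (x p : E) : Prop := p ∈ K ∧ ∀ y ∈ K, phi p x ≤ phi y x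

open Classical in
/-- The generalized projection `Π_K x`: the minimizer of `φ(·, x)` over `K`
(the arbitrary value `x` if there is none). -/
def genProj (K : Set E) (x : E) : E := if h : ∃ p, IsGenProj K x p then h.choose else x

/-- Conditions (A1)-(A4) on a bifunction `F : C × C → ℝ`; only values on `C × C` are used. -/
structure IsEquilibriumBifunction (C : Set E) (F : E → E → ℝ) : Prop where
  diag : ∀ x ∈ C, F x x = 0
  monotone : ∀ x ∈ C, ∀ y ∈ C, F x y + F y x ≤ 0
  upperHemicontinuous : ∀ x ∈ C, ∀ y ∈ C, ∀ z ∈ C,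
    limsup (fun t : ℝ => (F (t • z + (1 - t) • x) y : EReal)) (𝓝[>] 0) ≤ (F x y : EReal)
  convex : ∀ x ∈ C, ConvexOn ℝ C (F x)
  lowerSemicontinuous : ∀ x ∈ C, LowerSemicontinuousOn (F x) C

/-- The solution set `EP(F)` of the equilibrium problem. -/
def equilibriumSet (C : Set E) (F : E → E → ℝ) : Set E :=
  {x | x ∈ C ∧ ∀ y ∈ C, 0 ≤ F x y}

/-- `T` is a multivalued mapping from `C` to the nonempty subsets of `C`
(only its values on `C` are used). -/
def IsMultimap (C : Set E) (T : E → Set E) : Prop :=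
  ∀ x ∈ C, (T x).Nonempty ∧ T x ⊆ C

/-- The set of fixed points of a multivalued mapping on `C`. -/
def fixedPoints (C : Set E) (T : E → Set E) : Set E := {x | x ∈ C ∧ x ∈ T x}

/-- The best-approximation selection `P_T x = {y ∈ T x : ‖x - y‖ = dist(x, T x)}`. -/
def bestApprox (T : E → Set E) (x : E) : Set E :=
  {y | y ∈ T x ∧ ‖x - y‖ = Metric.infDist x (T x)}

/-- `Φ(A, B) = max {sup_{q ∈ B} inf_{y ∈ A} φ(y, q), sup_{y ∈ A} inf_{q ∈ B} φ(y, q)}`,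
as an extended real number. -/
def bigPhi (A B : Set E) : EReal :=
  max (⨆ q ∈ B, ⨅ y ∈ A, (phi y q : EReal)) (⨆ y ∈ A, ⨅ q ∈ B, (phi y q : EReal))

/-- Relatively quasi-nonexpansive multivalued mappings. The fixed point stands in the first
argument, so that `T x = {S x}` with `S` single-valued gives `φ(p, S x) ≤ φ(p, x)`. -/
def IsRelQuasiNonexpansive (C : Set E) (T : E → Set E) : Prop :=
  IsMultimap C T ∧ (fixedPoints C T).Nonempty ∧
    ∀ p ∈ fixedPoints C T, ∀ x ∈ C, bigPhi (T p) (T x) ≤ (phi p x : EReal)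

/-- Closed multivalued mappings. -/
def IsClosedMultimap (C : Set E) (T : E → Set E) : Prop :=
  ∀ (w : ℕ → E) (v : E), (∀ n, w n ∈ C) → Tendsto w atTop (𝓝 v) →
    Tendsto (fun n => Metric.infDist (w n) (T (w n))) atTop (𝓝 0) → v ∈ T v

/-- The sequences `x, y, u, z` and the sets `K n` are generated by the shrinking projection
algorithm from the starting point `x₀`. The mapping `T i` and the points `z n i` (`i = 0, 1, …`)
go with the weight `a n (i + 1)`. -/
structure IsShrinkingScheme (C : Set E) (F : E → E → ℝ) (T : ℕ → E → Set E) (a : ℕ → ℕ → ℝ)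
    (r : ℕ → ℝ) (x₀ : E) (x y u : ℕ → E) (z : ℕ → ℕ → E) (K : ℕ → Set E) : Prop where
  x_zero : x 0 = x₀
  K_zero : K 0 = C
  z_mem : ∀ n i, z n i ∈ bestApprox (T i) (x n)
  y_eq : ∀ n, y n =
    dualityInv (a n 0 • dualityMap (x n) + ∑' i : ℕ, a n (i + 1) • dualityMap (z n i))
  u_mem : ∀ n, u n ∈ C
  u_resolvent : ∀ n, ∀ v ∈ C,
    0 ≤ F (u n) v + 1 / r n * (dualityMap (u n) - dualityMap (y n)) (v - u n)
  K_succ : ∀ n, K (n + 1) = {v | v ∈ K n ∧ phi v (u n) ≤ phi v (x n)}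
  x_succ : ∀ n, x (n + 1) = genProj (K (n + 1)) x₀

end

end ShrinkingProjection

open ShrinkingProjection

/-! The main geometric tool is that in a uniformly convex space a small parallelogram defect
`2‖x‖² + 2‖y‖² - ‖x + y‖²` of bounded points forces `‖x - y‖` to be small
(`exists_le_parallelogram_defect`). It is used in three ways.

* For a functional `f`, sequences that are asymptotically minimizing for `‖y‖² - 2 f y` over convex
  sets are Cauchy (`cauchySeq_of_tendsto_of_le_midpoint`). So generalized projections onto closed
  convex sets exist, `J` is surjective, and the iterates `x n`, being projections of `x₀` onto
  decreasing convex sets, converge to some `w`, without recourse to weak topologies.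
* The defect of `x`, `y` is at most `2 φ(x, y)`, so `φ(x n, v n) → 0` and `x n → w` give `v n → w`
  (`tendsto_of_tendsto_phi`).
* The dual of a uniformly smooth space is uniformly convex, so `J` is single-valued and continuous
  (`UniformlySmooth.tendsto_dualitySet`).

For a common solution `p` the basic estimate (`IsShrinkingScheme.phi_add_le`) is
`φ(p, u n) + φ(u n, y n) + a n (j + 1) * φ(y n, z n j) ≤ φ(p, x n)`. It puts the solution set inside
every `K n`. As `φ(x (n + 1), u n) ≤ φ(x (n + 1), x n) → 0`, also `u n → w`, so
`φ(p, x n) - φ(p, u n) → 0` by continuity of `J`, and the estimate then yields `y n → w` and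
`z n j → w`. Closedness of the best-approximation maps makes `w` a common fixed point, and Minty's
lemma makes it a solution of the equilibrium problem. Finally `w` minimizes `φ(·, x₀)` over the
convex set `⋂ n, K n`, which contains the solution set, and this gives both minimality and
uniqueness without knowing that the solution set is convex. -/

namespace ShrinkingProjection

/-! ### The parallelogram defect in uniformly convex spaces -/

section Defect

variable {V : Type*} [NormedAddCommGroup V] [NormedSpace ℝ V]

/-- The linear terms cancel, so the defect measures how much `‖·‖² - 2 f` drops at the midpoint. -/
theorem parallelogram_defect_eq (f : StrongDual ℝ V) (x y : V) :
    2 * ‖x‖ ^ 2 + 2 * ‖y‖ ^ 2 - ‖x + y‖ ^ 2 = 2 * (‖x‖ ^ 2 - 2 * f x) + 2 * (‖y‖ ^ 2 - 2 * f y)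
      - 4 * (‖midpoint ℝ x y‖ ^ 2 - 2 * f (midpoint ℝ x y)) := by
  have h : midpoint ℝ x y = (2⁻¹ : ℝ) • (x + y) := by
    rw [midpoint_eq_smul_add, invOf_eq_inv]
  rw [h, norm_smul, map_smul, map_add]
  simp only [norm_inv, Real.norm_ofNat, smul_eq_mul]
  ring

theorem neg_sq_norm_le (f : StrongDual ℝ V) (y : V) : -‖f‖ ^ 2 ≤ ‖y‖ ^ 2 - 2 * f y := by
  have h1 : f y ≤ ‖f‖ * ‖y‖ := (le_abs_self _).trans (f.le_opNorm y)
  nlinarith [sq_nonneg (‖y‖ - ‖f‖)]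

variable [UniformConvexSpace V]

/-- In a uniformly convex space the squared norm is uniformly convex on bounded sets, expressed
through the defect of the parallelogram law at points of possibly different norms. -/
theorem exists_le_parallelogram_defect (R : ℝ) {ε : ℝ} (hε : 0 < ε) :
    ∃ η > 0, ∀ x y : V, ‖x‖ ≤ R → ‖y‖ ≤ R → ε ≤ ‖x - y‖ →
      η ≤ 2 * ‖x‖ ^ 2 + 2 * ‖y‖ ^ 2 - ‖x + y‖ ^ 2 := by
  have hR : 0 < max R 1 := lt_max_of_lt_right one_pos
  obtain ⟨δ₀, hδ₀, h₀⟩ := exists_forall_closed_ball_dist_add_le_two_sub V (div_pos hε hR)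
  obtain ⟨δ, hδ, hδ1, hδδ₀⟩ : ∃ δ : ℝ, 0 < δ ∧ δ ≤ 1 ∧ δ ≤ δ₀ :=
    ⟨min δ₀ 1, lt_min hδ₀ one_pos, min_le_right _ _, min_le_left _ _⟩
  have key : ∀ x y : V, ‖x‖ ≤ R → ‖y‖ ≤ ‖x‖ → ε ≤ ‖x - y‖ →
      δ ^ 2 * ε ^ 2 / 16 ≤ 2 * ‖x‖ ^ 2 + 2 * ‖y‖ ^ 2 - ‖x + y‖ ^ 2 := by
    intro x y hx hyx hxy
    have hs : ε / 2 ≤ ‖x‖ := by linarith [norm_sub_le x y]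
    have hs0 : 0 < ‖x‖ := by linarith
    -- rescale to the unit ball by the larger of the two norms
    have hsum : ‖x + y‖ ≤ ‖x‖ * (2 - δ) := by
      have h := @h₀ (‖x‖⁻¹ • x) (by rw [norm_smul, norm_inv, norm_norm, inv_mul_cancel₀ hs0.ne'])
        (‖x‖⁻¹ • y) (by
          rw [norm_smul, norm_inv, norm_norm, inv_mul_le_iff₀ hs0]; linarith) (by
          rw [← smul_sub, norm_smul, norm_inv, norm_norm, div_le_iff₀ hR, mul_assoc,
            le_inv_mul_iff₀ hs0, mul_comm]
          exact mul_le_mul hxy (hx.trans (le_max_left _ _)) hs0.le (norm_nonneg _))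
      rw [← smul_add, norm_smul, norm_inv, norm_norm, inv_mul_le_iff₀ hs0] at h
      exact h.trans (by gcongr)
    have htri := norm_add_le x y
    have hε2 : ε ^ 2 / 4 ≤ ‖x‖ ^ 2 := by nlinarith
    have h0 := norm_nonneg (x + y)
    have h0y := norm_nonneg y
    generalize ‖x + y‖ = m at *
    generalize ‖x‖ = s at *
    generalize ‖y‖ = t at *
    have hδs : 0 < δ * s := by positivity
    rcases le_total (s - t) (δ * s / 2) with hk | hk
    · -- nearly equal norms: the bound on `‖x + y‖` decides
      have h1 : m ^ 2 ≤ (s * (2 - δ)) ^ 2 := pow_le_pow_left₀ h0 hsum 2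
      have h2 : s * (s - t) ≤ s * (δ * s / 2) := by gcongr
      have h3 : δ ^ 2 * s ^ 2 ≤ δ * s ^ 2 := by
        gcongr; nlinarith
      have h4 : δ ^ 2 * (ε ^ 2 / 4) ≤ δ ^ 2 * s ^ 2 := by gcongr
      nlinarith [sq_nonneg (s - t), sq_nonneg (δ * ε)]
    · -- different norms: the triangle inequality decides
      have h1 : m ^ 2 ≤ (s + t) ^ 2 := pow_le_pow_left₀ h0 htri 2
      have h2 : (δ * s / 2) ^ 2 ≤ (s - t) ^ 2 := pow_le_pow_left₀ (by positivity) hk 2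
      have h4 : δ ^ 2 * (ε ^ 2 / 4) ≤ δ ^ 2 * s ^ 2 := by gcongr
      nlinarith
  refine ⟨δ ^ 2 * ε ^ 2 / 16, by positivity, fun x y hx hy hxy => ?_⟩
  rcases le_total ‖y‖ ‖x‖ with h | h
  · exact key x y hx h hxy
  · have := key y x hy h (by rwa [norm_sub_rev])
    rw [add_comm y x] at this
    linarith

theorem tendsto_norm_sub_of_parallelogram_defect {x y : ℕ → V} {R : ℝ} (hx : ∀ n, ‖x n‖ ≤ R)
    (hy : ∀ n, ‖y n‖ ≤ R) {d : ℕ → ℝ} (hd : Tendsto d atTop (𝓝 0))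
    (h : ∀ n, 2 * ‖x n‖ ^ 2 + 2 * ‖y n‖ ^ 2 - ‖x n + y n‖ ^ 2 ≤ d n) :
    Tendsto (fun n => ‖x n - y n‖) atTop (𝓝 0) := by
  rw [Metric.tendsto_nhds]
  intro ε hε
  obtain ⟨η, hη, key⟩ := exists_le_parallelogram_defect (V := V) R hε
  filter_upwards [hd.eventually_lt_const hη] with n hn
  rw [Real.dist_eq, sub_zero, abs_norm]
  by_contra! hc
  linarith [key _ _ (hx n) (hy n) hc, h n]

/-! ### Minimizing `‖y‖² - 2 f y` over a convex set -/

/-- A sequence along which `‖·‖² - 2 f` converges to `ℓ`, and whose midpoints have asymptotically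
no smaller values, is Cauchy. -/
theorem cauchySeq_of_tendsto_of_le_midpoint (f : StrongDual ℝ V) {x : ℕ → V} {b : ℕ → ℝ} {ℓ : ℝ}
    (hx : Tendsto (fun n => ‖x n‖ ^ 2 - 2 * f (x n)) atTop (𝓝 ℓ)) (hb : Tendsto b atTop (𝓝 ℓ))
    (hmid : ∀ n m, n ≤ m →
      b n ≤ ‖midpoint ℝ (x n) (x m)‖ ^ 2 - 2 * f (midpoint ℝ (x n) (x m))) :
    CauchySeq x := by
  obtain ⟨B, hB⟩ := hx.bddAbove_range
  have hbound : ∀ n, ‖x n‖ ≤ 2 * ‖f‖ + |B| + 1 := by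
    intro n
    have h1 : ‖x n‖ ^ 2 - 2 * f (x n) ≤ B := hB ⟨n, rfl⟩
    have h2 : f (x n) ≤ ‖f‖ * ‖x n‖ := (le_abs_self _).trans (f.le_opNorm _)
    by_contra! hc
    have h3 := le_abs_self B
    have h4 := abs_nonneg B
    have h5 := norm_nonneg f
    nlinarith
  rw [Metric.cauchySeq_iff']
  intro ε hε
  obtain ⟨η, hη, key⟩ := exists_le_parallelogram_defect (V := V) (2 * ‖f‖ + |B| + 1) hε
  have h1 := hx.eventually_lt_const (show ℓ < ℓ + η / 8 by linarith)
  have h2 := hb.eventually_const_lt (show ℓ - η / 8 < ℓ by linarith)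
  obtain ⟨N, hN⟩ := (h1.and h2).exists_forall_of_atTop
  refine ⟨N, fun n hn => ?_⟩
  rw [dist_comm, dist_eq_norm]
  by_contra! hc
  have h3 := key _ _ (hbound N) (hbound n) hc
  rw [parallelogram_defect_eq f] at h3
  linarith [hmid N n hn, (hN N le_rfl).1, (hN N le_rfl).2, (hN n hn).1]

theorem eq_of_isMinOn_sq_sub (f : StrongDual ℝ V) {K : Set V} (hK : Convex ℝ K) {p q : V}
    (hp : p ∈ K) (hq : q ∈ K) (hpm : ∀ y ∈ K, ‖p‖ ^ 2 - 2 * f p ≤ ‖y‖ ^ 2 - 2 * f y)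
    (hqm : ∀ y ∈ K, ‖q‖ ^ 2 - 2 * f q ≤ ‖y‖ ^ 2 - 2 * f y) : p = q := by
  by_contra hne
  obtain ⟨η, hη, key⟩ := exists_le_parallelogram_defect (V := V) (max ‖p‖ ‖q‖)
    (norm_sub_pos_iff.2 hne)
  have h := key p q (le_max_left _ _) (le_max_right _ _) le_rfl
  rw [parallelogram_defect_eq f] at h
  linarith [hpm _ (hK.midpoint_mem hp hq), hqm _ (hK.midpoint_mem hp hq)]

theorem exists_isMinOn_sq_sub [CompleteSpace V] (f : StrongDual ℝ V) {K : Set V}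
    (hne : K.Nonempty) (hcl : IsClosed K) (hK : Convex ℝ K) :
    ∃ p ∈ K, ∀ y ∈ K, ‖p‖ ^ 2 - 2 * f p ≤ ‖y‖ ^ 2 - 2 * f y := by
  set Q : V → ℝ := fun y => ‖y‖ ^ 2 - 2 * f y with hQ
  have hbdd : BddBelow (Q '' K) :=
    ⟨-‖f‖ ^ 2, by rintro _ ⟨y, -, rfl⟩; exact neg_sq_norm_le f y⟩
  obtain ⟨v, -, hv, hvK⟩ := exists_seq_tendsto_sInf (hne.image Q) hbdd
  choose x hxK hxv using hvK
  have hxlim : Tendsto (fun n => Q (x n)) atTop (𝓝 (sInf (Q '' K))) := by simpa only [hxv] using hv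
  have hlow : ∀ y ∈ K, sInf (Q '' K) ≤ Q y := fun y hy => csInf_le hbdd ⟨y, hy, rfl⟩
  obtain ⟨p, hp⟩ := cauchySeq_tendsto_of_complete (cauchySeq_of_tendsto_of_le_midpoint f hxlim
    tendsto_const_nhds fun n m _ => hlow _ (hK.midpoint_mem (hxK n) (hxK m)))
  refine ⟨p, hcl.mem_of_tendsto hp (Eventually.of_forall hxK), fun y hy => ?_⟩
  have hcont : Continuous Q := by fun_prop
  have := tendsto_nhds_unique ((hcont.tendsto p).comp hp) hxlim
  change Q p ≤ Q y
  rw [this]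
  exact hlow y hy

end Defect

/-! ### The duality mapping -/

section Duality

variable {E : Type*} [NormedAddCommGroup E] [NormedSpace ℝ E]

/-- The dual of a uniformly smooth space is uniformly convex: if `‖f + g‖` is close to `2`, test
at a nearly norming unit vector `x` perturbed by `± t y`, where `y` separates `f` from `g`. -/
theorem UniformlySmooth.uniformConvexSpace_dual (hE : UniformlySmooth E) :
    UniformConvexSpace (StrongDual ℝ E) := by
  refine ⟨fun ε hε => ?_⟩
  obtain ⟨L, hL⟩ := hE
  obtain ⟨δ, hδ, h⟩ := hL (ε / 8) (by positivity)
  obtain ⟨t, ht0, ht1, htδ⟩ : ∃ t : ℝ, 0 < t ∧ t ≤ 1 ∧ t < δ :=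
    ⟨min (δ / 2) 1, lt_min (half_pos hδ) one_pos, min_le_right _ _,
      (min_le_left _ _).trans_lt (half_lt_self hδ)⟩
  refine ⟨t * ε / 4, by positivity, fun f hf g hg hfg => ?_⟩
  have hε2 : ε ≤ 2 := by linarith [norm_sub_le f g]
  obtain ⟨y, hy, hysep⟩ : ∃ y : E, ‖y‖ = 1 ∧ ε / 2 < (f - g) y := by
    by_contra! hc
    have : ‖f - g‖ ≤ ε / 2 := by
      refine ContinuousLinearMap.opNorm_le_of_unit_norm (by positivity) fun y hy => ?_
      rw [Real.norm_eq_abs, abs_le']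
      refine ⟨hc y hy, ?_⟩
      rw [← map_neg]
      exact hc (-y) (by rwa [norm_neg])
    linarith
  have hmain : ∀ x : E, ‖x‖ = 1 → (f + g) x ≤ 2 - t * ε / 4 := by
    intro x hx
    have h1 := (abs_lt.1 (h x y hx hy t ht0.ne' (by rwa [abs_of_pos ht0]))).2
    have h2 := (abs_lt.1 (h x y hx hy (-t) (neg_ne_zero.2 ht0.ne')
      (by rwa [abs_neg, abs_of_pos ht0]))).1
    rw [hx, sub_lt_iff_lt_add, div_lt_iff₀ ht0] at h1
    rw [hx, div_neg, lt_sub_iff_add_lt, lt_neg, div_lt_iff₀ ht0, neg_smul] at h2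
    have h3 : f (x + t • y) ≤ ‖x + t • y‖ := by
      simpa [hf] using (le_abs_self _).trans (f.le_opNorm (x + t • y))
    have h4 : g (x + -(t • y)) ≤ ‖x + -(t • y)‖ := by
      simpa [hg] using (le_abs_self _).trans (g.le_opNorm (x + -(t • y)))
    simp only [map_add, map_neg, map_smul, smul_eq_mul, FunLike.coe_add, FunLike.coe_sub,
      Pi.add_apply, Pi.sub_apply] at h3 h4 hysep ⊢
    nlinarith
  refine ContinuousLinearMap.opNorm_le_of_unit_norm (by nlinarith) fun x hx => ?_
  rw [Real.norm_eq_abs, abs_le']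
  refine ⟨hmain x hx, ?_⟩
  rw [← map_neg]
  exact hmain (-x) (by rwa [norm_neg])

theorem norm_dualityMap (x : E) : ‖dualityMap x‖ = ‖x‖ :=
  (dualitySet_nonempty x).choose_spec.2.symm

theorem dualityMap_apply_self (x : E) : dualityMap x x = ‖x‖ ^ 2 := by
  have h : dualityMap x x = ‖x‖ * ‖dualityMap x‖ := (dualitySet_nonempty x).choose_spec.1
  rw [h, norm_dualityMap, sq]

theorem dualityMap_apply_le (x y : E) : dualityMap x y ≤ ‖x‖ * ‖y‖ := by
  simpa only [norm_dualityMap] using (le_abs_self _).trans ((dualityMap x).le_opNorm y)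

/-- A duality functional depends continuously on its base point, whichever functionals of the
duality sets are chosen; constant sequences give single-valuedness of the duality mapping. -/
theorem UniformlySmooth.tendsto_dualitySet (hE : UniformlySmooth E) {x : ℕ → E} {w : E}
    (hx : Tendsto x atTop (𝓝 w)) {f : ℕ → StrongDual ℝ E} {g : StrongDual ℝ E}
    (hf : ∀ n, f n ∈ dualitySet (x n)) (hg : g ∈ dualitySet w) :
    Tendsto f atTop (𝓝 g) := by
  have := hE.uniformConvexSpace_dual
  obtain ⟨B, hB⟩ := hx.norm.bddAbove_range
  have hxB : ∀ n, ‖x n‖ ≤ B := fun n => hB ⟨n, rfl⟩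
  have hwB : ‖w‖ ≤ B := le_of_tendsto' hx.norm hxB
  rw [tendsto_iff_norm_sub_tendsto_zero]
  have hd : Tendsto (fun n => 2 * ‖x n‖ ^ 2 + 2 * ‖w‖ ^ 2
      - 4 * ((‖x n‖ ^ 2 + ‖w‖ ^ 2 - B * ‖x n - w‖) - ‖w‖ ^ 2)) atTop (𝓝 0) := by
    have hxw := tendsto_iff_norm_sub_tendsto_zero.1 hx
    have := (((hx.norm.pow 2).const_mul 2).add_const (2 * ‖w‖ ^ 2)).sub
      ((((((hx.norm.pow 2).add_const (‖w‖ ^ 2)).sub (hxw.const_mul B))).sub_const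
        (‖w‖ ^ 2)).const_mul 4)
    convert this using 2
    ring
  refine tendsto_norm_sub_of_parallelogram_defect (R := B) (fun n => (hf n).2 ▸ hxB n)
    (fun _ => hg.2 ▸ hwB) hd fun n => ?_
  have h1 : (f n + g) w ≤ ‖f n + g‖ * ‖w‖ := (le_abs_self _).trans ((f n + g).le_opNorm w)
  have h2 : f n (x n - w) ≤ B * ‖x n - w‖ := by
    refine ((le_abs_self _).trans ((f n).le_opNorm _)).trans ?_
    gcongr
    exact (hf n).2 ▸ hxB n
  have h3 := (hf n).1
  have h4 := hg.1
  rw [← (hf n).2] at h3 ⊢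
  rw [← hg.2] at h4 ⊢
  simp only [map_sub, FunLike.coe_add, Pi.add_apply] at h1 h2
  nlinarith [sq_nonneg (‖f n + g‖ - 2 * ‖w‖)]

theorem UniformlySmooth.tendsto_dualityMap (hE : UniformlySmooth E) {x : ℕ → E} {w : E}
    (hx : Tendsto x atTop (𝓝 w)) :
    Tendsto (fun n => dualityMap (x n)) atTop (𝓝 (dualityMap w)) :=
  hE.tendsto_dualitySet hx (fun n => (dualitySet_nonempty (x n)).choose_spec)
    (dualitySet_nonempty w).choose_spec

theorem UniformlySmooth.eq_dualityMap (hE : UniformlySmooth E) {x : E} {f : StrongDual ℝ E}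
    (hf : f ∈ dualitySet x) : dualityMap x = f :=
  tendsto_nhds_unique tendsto_const_nhds
    (hE.tendsto_dualitySet tendsto_const_nhds
      (fun _ : ℕ => (dualitySet_nonempty x).choose_spec) hf)

/-- A preimage of `f` under the duality mapping is the minimizer of `‖y‖² - 2 f y`. -/
theorem UniformlySmooth.dualityMap_surjective [CompleteSpace E] [UniformConvexSpace E]
    (hE : UniformlySmooth E) : Function.Surjective (dualityMap (E := E)) := by
  intro f
  obtain ⟨x, -, hx⟩ := exists_isMinOn_sq_sub f Set.univ_nonempty isClosed_univ convex_univ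
  refine ⟨x, hE.eq_dualityMap ?_⟩
  -- minimality along the ray through `x`
  have hfx : f x = ‖x‖ ^ 2 := by
    have h : ∀ t : ℝ, 0 ≤ (t ^ 2 - 1) * ‖x‖ ^ 2 - 2 * (t - 1) * f x := by
      intro t
      have := hx (t • x) trivial
      rw [norm_smul, mul_pow, Real.norm_eq_abs, sq_abs, map_smul, smul_eq_mul] at this
      linarith
    by_contra hne
    have h0 : 0 < (‖x‖ ^ 2 - f x) ^ 2 := by
      have : ‖x‖ ^ 2 - f x ≠ 0 := fun h => hne (by linarith)
      positivity
    have h1 : 0 < ‖x‖ ^ 2 + 1 := by positivity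
    -- the step `s` at which the quadratic in `t = 1 - s` would become negative
    have h2 := h (1 - (‖x‖ ^ 2 - f x) / (‖x‖ ^ 2 + 1))
    have h3 : ((1 - (‖x‖ ^ 2 - f x) / (‖x‖ ^ 2 + 1)) ^ 2 - 1) * ‖x‖ ^ 2
        - 2 * ((1 - (‖x‖ ^ 2 - f x) / (‖x‖ ^ 2 + 1)) - 1) * f x
        = -((‖x‖ ^ 2 - f x) ^ 2 * (‖x‖ ^ 2 + 2) / (‖x‖ ^ 2 + 1) ^ 2) := by
      field_simp
      ring
    rw [h3] at h2
    have : 0 < (‖x‖ ^ 2 - f x) ^ 2 * (‖x‖ ^ 2 + 2) / (‖x‖ ^ 2 + 1) ^ 2 := by positivity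
    linarith
  have hle : ‖f‖ ≤ ‖x‖ := by
    refine ContinuousLinearMap.opNorm_le_of_unit_norm (norm_nonneg _) fun y hy => ?_
    -- minimality compared with the multiple `f y • y`
    have := hx (f y • y) trivial
    rw [norm_smul, hy, mul_one, Real.norm_eq_abs, sq_abs, map_smul, smul_eq_mul, hfx] at this
    exact abs_le_of_sq_le_sq (by nlinarith) (norm_nonneg _)
  have hge : ‖x‖ ≤ ‖f‖ := by
    rcases (norm_nonneg x).eq_or_lt with h0 | h0
    · rw [← h0]; exact norm_nonneg _
    · have : f x ≤ ‖f‖ * ‖x‖ := (le_abs_self _).trans (f.le_opNorm x)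
      rw [hfx, sq] at this
      exact le_of_mul_le_mul_right this h0
  exact ⟨by rw [hfx, le_antisymm hle hge, sq], le_antisymm hge hle⟩

theorem UniformlySmooth.dualityMap_dualityInv [CompleteSpace E] [UniformConvexSpace E]
    (hE : UniformlySmooth E) (f : StrongDual ℝ E) : dualityMap (dualityInv f) = f :=
  Function.invFun_eq (hE.dualityMap_surjective f)

end Duality

/-! ### The functional `φ` -/

section Phi

variable {E : Type*} [NormedAddCommGroup E] [NormedSpace ℝ E]

theorem sq_norm_sub_norm_le_phi (x y : E) : (‖x‖ - ‖y‖) ^ 2 ≤ phi x y := by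
  have := dualityMap_apply_le y x
  unfold phi
  nlinarith

theorem phi_nonneg (x y : E) : 0 ≤ phi x y := (sq_nonneg _).trans (sq_norm_sub_norm_le_phi x y)

theorem phi_self (x : E) : phi x x = 0 := by
  rw [phi, dualityMap_apply_self]
  ring

theorem norm_le_of_phi_le {x y : E} {B : ℝ} (h : phi x y ≤ B) : ‖y‖ ≤ ‖x‖ + B + 1 := by
  nlinarith [sq_norm_sub_norm_le_phi x y, sq_nonneg (‖x‖ - ‖y‖ + 1)]

theorem phi_sub_phi (p q y : E) :
    phi p y - phi q y = ‖p‖ ^ 2 - ‖q‖ ^ 2 - 2 * dualityMap y (p - q) := by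
  rw [phi, phi, map_sub]
  ring

theorem phi_three_point (p u y : E) :
    phi p y = phi p u + phi u y + 2 * (dualityMap u - dualityMap y) (p - u) := by
  simp only [phi, FunLike.coe_sub, Pi.sub_apply, map_sub, dualityMap_apply_self]
  ring

theorem parallelogram_defect_le_phi (x y : E) :
    2 * ‖x‖ ^ 2 + 2 * ‖y‖ ^ 2 - ‖x + y‖ ^ 2 ≤ 2 * phi x y := by
  have h := dualityMap_apply_le y (x + y)
  rw [map_add, dualityMap_apply_self] at h
  unfold phi
  nlinarith [sq_nonneg (‖x + y‖ - 2 * ‖y‖)]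

theorem tendsto_of_tendsto_phi [UniformConvexSpace E] {x v : ℕ → E} {w : E}
    (hx : Tendsto x atTop (𝓝 w)) (hφ : Tendsto (fun n => phi (x n) (v n)) atTop (𝓝 0)) :
    Tendsto v atTop (𝓝 w) := by
  obtain ⟨B, hB⟩ := hx.norm.bddAbove_range
  obtain ⟨D, hD⟩ := hφ.bddAbove_range
  have hxB : ∀ n, ‖x n‖ ≤ B := fun n => hB ⟨n, rfl⟩
  have hφD : ∀ n, phi (x n) (v n) ≤ D := fun n => hD ⟨n, rfl⟩
  have hD0 : 0 ≤ D := (phi_nonneg _ _).trans (hφD 0)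
  have h := tendsto_norm_sub_of_parallelogram_defect (R := B + D + 1)
    (fun n => by linarith [hxB n]) (fun n => by linarith [norm_le_of_phi_le (hφD n), hxB n])
    (by simpa using hφ.const_mul 2) fun n => parallelogram_defect_le_phi (x n) (v n)
  simpa using hx.sub (tendsto_zero_iff_norm_tendsto_zero.2 h)

theorem UniformlySmooth.tendsto_phi_right (hE : UniformlySmooth E) (p : E) {v : ℕ → E} {w : E}
    (hv : Tendsto v atTop (𝓝 w)) : Tendsto (fun n => phi p (v n)) atTop (𝓝 (phi p w)) := by
  have hJ : Tendsto (fun n => dualityMap (v n) p) atTop (𝓝 (dualityMap w p)) :=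
    ((ContinuousLinearMap.apply ℝ ℝ p).continuous.tendsto _).comp (hE.tendsto_dualityMap hv)
  exact ((hJ.const_mul 2).const_sub (‖p‖ ^ 2)).add (hv.norm.pow 2)

theorem continuous_phi_left (y : E) : Continuous fun x => phi x y := by
  unfold phi
  fun_prop

theorem isClosed_phi_le (u x : E) : IsClosed {v : E | phi v u ≤ phi v x} :=
  isClosed_le (continuous_phi_left u) (continuous_phi_left x)

/-- The quadratic terms cancel, so this set is a half-space. -/
theorem convex_phi_le (u x : E) : Convex ℝ {v : E | phi v u ≤ phi v x} := by
  have h : {v : E | phi v u ≤ phi v x}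
      = {v : E | (dualityMap x - dualityMap u) v ≤ (‖x‖ ^ 2 - ‖u‖ ^ 2) / 2} := by
    ext v
    simp only [phi, Set.mem_ofPred_eq, FunLike.coe_sub, Pi.sub_apply]
    constructor <;> intro h <;> linarith
  rw [h]
  exact convex_halfSpace_le (dualityMap x - dualityMap u).toLinearMap.isLinear _

theorem phi_le_phi_iff {p q y : E} : phi p y ≤ phi q y ↔
    ‖p‖ ^ 2 - 2 * dualityMap y p ≤ ‖q‖ ^ 2 - 2 * dualityMap y q := by
  simp only [phi, add_le_add_iff_right]

theorem isGenProj_genProj [CompleteSpace E] [UniformConvexSpace E] {K : Set E}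
    (hne : K.Nonempty) (hcl : IsClosed K) (hK : Convex ℝ K) (y : E) :
    IsGenProj K y (genProj K y) := by
  have h : ∃ p, IsGenProj K y p := by
    obtain ⟨p, hp, hmin⟩ := exists_isMinOn_sq_sub (dualityMap y) hne hcl hK
    exact ⟨p, hp, fun q hq => phi_le_phi_iff.2 (hmin q hq)⟩
  rw [genProj, dif_pos h]
  exact h.choose_spec

theorem IsGenProj.eq [UniformConvexSpace E] {K : Set E} (hK : Convex ℝ K) {y p q : E}
    (hp : IsGenProj K y p) (hq : IsGenProj K y q) : p = q :=
  eq_of_isMinOn_sq_sub (dualityMap y) hK hp.1 hq.1 (fun v hv => phi_le_phi_iff.1 (hp.2 v hv))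
    fun v hv => phi_le_phi_iff.1 (hq.2 v hv)

/-- The sum over `i` of `a i * (φ(p, x) - φ(p, w i) + φ(y, w i))`, whose terms are nonnegative, is
`φ(p, x) - φ(p, y)`: the difference `φ(p, w) - φ(y, w)` is affine in `J w`. -/
theorem phi_add_mul_phi_le_of_hasSum {a : ℕ → ℝ} (ha : ∀ i, 0 ≤ a i) (hsum : HasSum a 1)
    {p x y : E} {w : ℕ → E} (hw : ∀ i, phi p (w i) ≤ phi p x)
    (hy : HasSum (fun i => a i • dualityMap (w i)) (dualityMap y)) (j : ℕ) :
    phi p y + a j * phi y (w j) ≤ phi p x := by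
  have h1 : HasSum (fun i => a i * dualityMap (w i) (p - y)) (dualityMap y (p - y)) := by
    simpa using hy.mapL (ContinuousLinearMap.apply ℝ ℝ (p - y))
  have h2 : HasSum (fun i => a i * (phi p x - phi p (w i) + phi y (w i)))
      (phi p x - phi p y) := by
    have hterm : ∀ i, a i * (phi p x - phi p (w i) + phi y (w i))
        = a i * (phi p x - (‖p‖ ^ 2 - ‖y‖ ^ 2)) + 2 * (a i * dualityMap (w i) (p - y)) :=
      fun i => by linear_combination -a i * phi_sub_phi p y (w i)
    have hval : phi p x - phi p y
        = 1 * (phi p x - (‖p‖ ^ 2 - ‖y‖ ^ 2)) + 2 * dualityMap y (p - y) := by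
      linarith [phi_sub_phi p y y, phi_self y]
    rw [hval]
    simp only [hterm]
    exact (hsum.mul_right _).add (h1.mul_left 2)
  have h3 := le_hasSum h2 j fun i _ =>
    mul_nonneg (ha i) (by linarith [hw i, phi_nonneg y (w i)])
  nlinarith [mul_nonneg (ha j) (sub_nonneg.2 (hw j))]

/-- The generalized convex combination `y = J⁻¹ (a₀ J x + ∑ aᵢ₊₁ J zᵢ)` of points that are no
farther from `p` than `x`. -/
theorem UniformlySmooth.phi_dualityInv_le [CompleteSpace E] [UniformConvexSpace E]
    (hE : UniformlySmooth E) {a : ℕ → ℝ} (ha : ∀ i, 0 ≤ a i) (hsum : HasSum a 1)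
    {p x y : E} {z : ℕ → E} (hz : ∀ i, phi p (z i) ≤ phi p x)
    (hy : y = dualityInv (a 0 • dualityMap x + ∑' i : ℕ, a (i + 1) • dualityMap (z i))) (j : ℕ) :
    phi p y + a (j + 1) * phi y (z j) ≤ phi p x := by
  set B := ‖p‖ + phi p x + 1
  have hsummable : Summable fun i => a (i + 1) • dualityMap (z i) := by
    refine Summable.of_norm_bounded
      (((summable_nat_add_iff 1).2 hsum.summable).mul_right B) fun i => ?_
    rw [norm_smul, norm_dualityMap, Real.norm_of_nonneg (ha _)]
    exact mul_le_mul_of_nonneg_left (norm_le_of_phi_le (hz i)) (ha _)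
  let w : ℕ → E := fun i => Nat.casesOn i x z
  have hw : HasSum (fun i => a i • dualityMap (w i)) (dualityMap y) := by
    rw [hy, hE.dualityMap_dualityInv, add_comm, ← hasSum_nat_add_iff' 1]
    simpa [w] using hsummable.hasSum
  exact phi_add_mul_phi_le_of_hasSum ha hsum (w := w) (by rintro (_ | i); exacts [le_rfl, hz i])
    hw (j + 1)

end Phi

/-! ### Best approximations and equilibrium problems -/

section Operators

variable {E : Type*} [NormedAddCommGroup E]

theorem bestApprox_of_mem {T : E → Set E} {p : E} (hp : p ∈ T p) : bestApprox T p = {p} := by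
  ext y
  simp only [bestApprox, Metric.infDist_zero_of_mem hp, Set.mem_ofPred_eq, Set.mem_singleton_iff]
  refine ⟨fun h => (sub_eq_zero.1 (norm_eq_zero.1 h.2)).symm, ?_⟩
  rintro rfl
  simpa using hp

variable [NormedSpace ℝ E]

theorem IsRelQuasiNonexpansive.phi_le {C : Set E} {T : E → Set E}
    (hT : IsRelQuasiNonexpansive C (bestApprox T)) {p : E} (hp : p ∈ fixedPoints C T) {x z : E}
    (hx : x ∈ C) (hz : z ∈ bestApprox T x) : phi p z ≤ phi p x := by
  have hpT := bestApprox_of_mem hp.2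
  have h := hT.2.2 p ⟨hp.1, by rw [hpT]; rfl⟩ x hx
  rw [hpT, bigPhi] at h
  have h1 := (le_iSup₂ (f := fun q (_ : q ∈ bestApprox T x) => ⨅ y ∈ ({p} : Set E),
    (phi y q : EReal)) z hz).trans ((le_max_left _ _).trans h)
  simpa only [Set.mem_singleton_iff, iInf_iInf_eq_left, EReal.coe_le_coe_iff] using h1

theorem IsEquilibriumBifunction.phi_resolvent_le {C : Set E} {F : E → E → ℝ}
    (hF : IsEquilibriumBifunction C F) {p u y : E} (hp : p ∈ equilibriumSet C F) (hu : u ∈ C)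
    {r : ℝ} (hr : 0 < r)
    (h : ∀ v ∈ C, 0 ≤ F u v + 1 / r * (dualityMap u - dualityMap y) (v - u)) :
    phi p u + phi u y ≤ phi p y := by
  have h1 : 0 ≤ 1 / r * (dualityMap u - dualityMap y) (p - u) := by
    linarith [h p hp.1, hF.monotone u hu p hp.1, hp.2 u hu]
  have h2 := nonneg_of_mul_nonneg_right h1 (one_div_pos.2 hr)
  linarith [phi_three_point p u y]

/-- Minty's lemma: a solution of the dual problem `F(v, w) ≤ 0` solves the equilibrium problem. -/
theorem IsEquilibriumBifunction.mem_equilibriumSet {C : Set E} {F : E → E → ℝ}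
    (hF : IsEquilibriumBifunction C F) (hC : Convex ℝ C) {w : E} (hw : w ∈ C)
    (h : ∀ v ∈ C, F v w ≤ 0) : w ∈ equilibriumSet C F := by
  refine ⟨hw, fun v hv => ?_⟩
  have hev : ∀ᶠ t : ℝ in 𝓝[>] 0, (0 : EReal) ≤ (F (t • v + (1 - t) • w) v : EReal) := by
    filter_upwards [Ioo_mem_nhdsGT (zero_lt_one' ℝ)] with t ht
    have hm : t • v + (1 - t) • w ∈ C := hC hv hw ht.1.le (sub_nonneg.2 ht.2.le) (by ring)
    have h1 := (hF.convex _ hm).2 hv hw ht.1.le (sub_nonneg.2 ht.2.le) (by ring)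
    rw [hF.diag _ hm, smul_eq_mul, smul_eq_mul] at h1
    have h2 := mul_nonpos_of_nonneg_of_nonpos (sub_nonneg.2 ht.2.le) (h _ hm)
    exact EReal.coe_nonneg.2 (nonneg_of_mul_nonneg_right (by linarith) ht.1)
  have h3 : (0 : EReal) ≤ limsup (fun t : ℝ => (F (t • v + (1 - t) • w) v : EReal)) (𝓝[>] 0) :=
    le_limsup_of_frequently_le hev.frequently
  exact EReal.coe_nonneg.1 (h3.trans (hF.upperHemicontinuous w hw v hv v hv))

/-- A limit of approximate resolvents solves the equilibrium problem. -/
theorem IsEquilibriumBifunction.mem_equilibriumSet_of_tendsto {C : Set E} {F : E → E → ℝ}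
    (hF : IsEquilibriumBifunction C F) (hC : Convex ℝ C) {u : ℕ → E} {w : E} (hw : w ∈ C)
    (hu : ∀ n, u n ∈ C) (huw : Tendsto u atTop (𝓝 w)) {g : ℕ → StrongDual ℝ E}
    (hg : Tendsto g atTop (𝓝 0)) {r : ℕ → ℝ} (hr : ∀ n, 0 < r n) {c : ℝ} (hc : 0 < c)
    (hrc : ∀ᶠ n in atTop, c ≤ r n) (h : ∀ n, ∀ v ∈ C, 0 ≤ F (u n) v + 1 / r n * g n (v - u n)) :
    w ∈ equilibriumSet C F := by
  refine hF.mem_equilibriumSet hC hw fun v hv => ?_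
  have hlim : Tendsto (fun n => 1 / c * (‖g n‖ * ‖v - u n‖)) atTop (𝓝 0) := by
    simpa using (hg.norm.mul (huw.const_sub v).norm).const_mul (1 / c)
  by_contra! hpos
  have hlsc : ∀ᶠ n in atTop, F v w / 2 < F v (u n) :=
    (tendsto_nhdsWithin_iff.2 ⟨huw, Eventually.of_forall hu⟩).eventually
      (hF.lowerSemicontinuous v hv w hw (F v w / 2) (half_lt_self hpos))
  obtain ⟨n, h1, h2, h3⟩ :=
    (hlsc.and ((hlim.eventually_lt_const (half_pos hpos)).and hrc)).exists
  have h4 : 1 / r n * g n (v - u n) ≤ 1 / c * (‖g n‖ * ‖v - u n‖) := by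
    have h5 : g n (v - u n) ≤ ‖g n‖ * ‖v - u n‖ := (le_abs_self _).trans ((g n).le_opNorm _)
    have h6 : 1 / r n ≤ 1 / c := one_div_le_one_div_of_le hc h3
    have h7 := hr n
    calc 1 / r n * g n (v - u n) ≤ 1 / r n * (‖g n‖ * ‖v - u n‖) := by gcongr
      _ ≤ _ := by gcongr
  linarith [h n v hv, hF.monotone v hv (u n) (hu n)]

theorem exists_pos_eventually_le_of_liminf {s : ℕ → ℝ}
    (hs : 0 < liminf (fun n => (s n : EReal)) atTop) : ∃ c > 0, ∀ᶠ n in atTop, c ≤ s n := by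
  obtain ⟨c, hc0, hc⟩ := EReal.lt_iff_exists_real_btwn.1 hs
  exact ⟨c, EReal.coe_pos.1 hc0,
    (eventually_lt_of_lt_liminf hc).mono fun n hn => (EReal.coe_lt_coe_iff.1 hn).le⟩

end Operators

/-! ### The iteration -/

section Scheme

variable {E : Type*} [NormedAddCommGroup E] [NormedSpace ℝ E]
  {C : Set E} {F : E → E → ℝ} {T : ℕ → E → Set E} {a : ℕ → ℕ → ℝ}
  {r : ℕ → ℝ} {x₀ : E} {x y u : ℕ → E} {z : ℕ → ℕ → E} {K : ℕ → Set E}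

theorem IsShrinkingScheme.antitone (hs : IsShrinkingScheme C F T a r x₀ x y u z K) :
    Antitone K :=
  antitone_nat_of_succ_le fun n => by
    rw [hs.K_succ]
    exact fun v hv => hv.1

variable [UniformConvexSpace E]

/-- The generalized projections of `x₀` onto a decreasing sequence of convex sets form a Cauchy sequence,
provided that the sets have a common point. -/
theorem cauchySeq_of_isGenProj (hanti : Antitone K)
    (hconv : ∀ n, Convex ℝ (K n)) (hx : ∀ n, IsGenProj (K n) x₀ (x n)) {p : E}
    (hp : ∀ n, p ∈ K n) : CauchySeq x := by
  set Q : ℕ → ℝ := fun n => ‖x n‖ ^ 2 - 2 * dualityMap x₀ (x n)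
  have hmono : Monotone Q := fun n m hnm =>
    phi_le_phi_iff.1 ((hx n).2 _ (hanti hnm (hx m).1))
  have hbdd : BddAbove (Set.range Q) :=
    ⟨‖p‖ ^ 2 - 2 * dualityMap x₀ p, by
      rintro _ ⟨n, rfl⟩; exact phi_le_phi_iff.1 ((hx n).2 p (hp n))⟩
  have hlim := tendsto_atTop_ciSup hmono hbdd
  exact cauchySeq_of_tendsto_of_le_midpoint (dualityMap x₀) hlim hlim fun n m hnm =>
    phi_le_phi_iff.1 ((hx n).2 _ ((hconv n).midpoint_mem (hx n).1 (hanti hnm (hx m).1)))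

variable [CompleteSpace E]

/-- The basic estimate of the iteration: passing from `x n` to `u n` does not increase the distance
`φ(p, ·)` to a solution `p`, and the decrease controls `φ(u n, y n)` and `φ(y n, z n j)`. -/
theorem IsShrinkingScheme.phi_add_le (hs : IsShrinkingScheme C F T a r x₀ x y u z K)
    (hE : UniformlySmooth E) (hF : IsEquilibriumBifunction C F)
    (hT : ∀ i, IsRelQuasiNonexpansive C (bestApprox (T i))) (ha : ∀ n i, 0 ≤ a n i)
    (hsum : ∀ n, HasSum (a n) 1) (hr : ∀ n, 0 < r n) {p : E}
    (hp : p ∈ (⋂ i, fixedPoints C (T i)) ∩ equilibriumSet C F) {n : ℕ} (hx : x n ∈ C) (j : ℕ) :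
    phi p (u n) + phi (u n) (y n) + a n (j + 1) * phi (y n) (z n j) ≤ phi p (x n) := by
  have h1 := hE.phi_dualityInv_le (ha n) (hsum n)
    (fun i => (hT i).phi_le (Set.mem_iInter.1 hp.1 i) hx (hs.z_mem n i)) (hs.y_eq n) j
  have h2 := hF.phi_resolvent_le hp.2 (hs.u_mem n) (hr n) (hs.u_resolvent n)
  linarith

/-- The generalized projections in the scheme exist, because the sets `K n` are closed and convex
and keep containing `S`. Everything goes into one induction, since `x n ∈ C` is needed for
`S ⊆ K (n + 1)`. -/
theorem IsShrinkingScheme.invariants (hs : IsShrinkingScheme C F T a r x₀ x y u z K)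
    (hcl : IsClosed C) (hC : Convex ℝ C) (hx₀ : x₀ ∈ C) {S : Set E} (hSC : S ⊆ C)
    (hne : S.Nonempty) (hS : ∀ p ∈ S, ∀ n, x n ∈ C → phi p (u n) ≤ phi p (x n)) (n : ℕ) :
    IsClosed (K n) ∧ Convex ℝ (K n) ∧ K n ⊆ C ∧ S ⊆ K n ∧ IsGenProj (K n) x₀ (x n) := by
  induction n with
  | zero =>
    rw [hs.K_zero, hs.x_zero]
    exact ⟨hcl, hC, subset_rfl, hSC, hx₀, fun q _ => (phi_self x₀).trans_le (phi_nonneg q x₀)⟩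
  | succ n ih =>
    obtain ⟨h1, h2, h3, h4, h5⟩ := ih
    have hK : K (n + 1) = K n ∩ {v | phi v (u n) ≤ phi v (x n)} := hs.K_succ n
    have hcl' : IsClosed (K (n + 1)) := hK ▸ h1.inter (isClosed_phi_le _ _)
    have hcv' : Convex ℝ (K (n + 1)) := hK ▸ h2.inter (convex_phi_le _ _)
    have hS' : S ⊆ K (n + 1) := hK ▸ fun p hp => ⟨h4 hp, hS p hp n (h3 h5.1)⟩
    refine ⟨hcl', hcv', hK ▸ fun v hv => h3 hv.1, hS', ?_⟩
    rw [hs.x_succ]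
    exact isGenProj_genProj (hne.mono hS') hcl' hcv' x₀

end Scheme

end ShrinkingProjection

theorem theorem3p1 {E : Type*} [NormedAddCommGroup E] [NormedSpace ℝ E] [CompleteSpace E]
    [UniformConvexSpace E] (hE : UniformlySmooth E)
    (C : Set E) (hC_closed : IsClosed C) (hC_convex : Convex ℝ C)
    (F : E → E → ℝ) (hF : IsEquilibriumBifunction C F)
    (T : ℕ → E → Set E) (hT : ∀ i, IsMultimap C (T i))
    (hT_closed : ∀ i, IsClosedMultimap C (bestApprox (T i)))
    (hT_rqn : ∀ i, IsRelQuasiNonexpansive C (bestApprox (T i)))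
    (S : Set E) (hS : S = (⋂ i, fixedPoints C (T i)) ∩ equilibriumSet C F)
    (hS_nonempty : S.Nonempty)
    (a : ℕ → ℕ → ℝ) (ha_nonneg : ∀ n i, 0 ≤ a n i) (ha_sum : ∀ n, HasSum (a n) 1)
    (ha_liminf : ∀ i, 0 < liminf (fun n => ((a n 0 * a n (i + 1) : ℝ) : EReal)) atTop)
    (r : ℕ → ℝ) (hr_pos : ∀ n, 0 < r n)
    (hr_liminf : 0 < liminf (fun n => (r n : EReal)) atTop)
    (x₀ : E) (hx₀ : x₀ ∈ C)
    (x y u : ℕ → E) (z : ℕ → ℕ → E) (K : ℕ → Set E)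
    (hscheme : IsShrinkingScheme C F T a r x₀ x y u z K) :
    (∃! p, IsGenProj S x₀ p) ∧ Tendsto x atTop (𝓝 (genProj S x₀)) := by
  have hstep : ∀ p ∈ S, ∀ n, x n ∈ C → ∀ j,
      phi p (u n) + phi (u n) (y n) + a n (j + 1) * phi (y n) (z n j) ≤ phi p (x n) :=
    fun p hp n hx j => hscheme.phi_add_le hE hF hT_rqn ha_nonneg ha_sum hr_pos (hS ▸ hp) hx j
  have hSC : S ⊆ C := by
    rw [hS]
    exact fun p hp => hp.2.1
  have hinv := hscheme.invariants hC_closed hC_convex hx₀ hSC hS_nonempty fun p hp n hx => by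
    linarith [hstep p hp n hx 0, phi_nonneg (u n) (y n),
      mul_nonneg (ha_nonneg n 1) (phi_nonneg (y n) (z n 0))]
  have hxC : ∀ n, x n ∈ C := fun n => (hinv n).2.2.1 (hinv n).2.2.2.2.1
  have hSK : ∀ n, S ⊆ K n := fun n => (hinv n).2.2.2.1
  have hproj : ∀ n, IsGenProj (K n) x₀ (x n) := fun n => (hinv n).2.2.2.2
  obtain ⟨p, hp⟩ := hS_nonempty
  obtain ⟨w, hw⟩ := cauchySeq_tendsto_of_complete (cauchySeq_of_isGenProj hscheme.antitone
    (fun n => (hinv n).2.1) hproj fun n => hSK n hp)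
  have hwC : w ∈ C := hC_closed.mem_of_tendsto hw (Eventually.of_forall hxC)
  have hw1 : Tendsto (fun n => x (n + 1)) atTop (𝓝 w) := hw.comp (tendsto_add_atTop_nat 1)
  -- `x (n + 1) ∈ K (n + 1)` forces `u n` towards the common limit of `x (n + 1)` and `x n`
  have hu : Tendsto u atTop (𝓝 w) := by
    refine tendsto_of_tendsto_phi hw1 (squeeze_zero (fun n => phi_nonneg _ _) (fun n => ?_)
      (g := fun n => phi (x (n + 1)) (x n)) ?_)
    · have h := (hproj (n + 1)).1
      rw [hscheme.K_succ] at h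
      exact h.2
    · have hJ := hE.tendsto_dualityMap hw
      have hJx : Tendsto (fun n => dualityMap (x n) (x (n + 1))) atTop (𝓝 (dualityMap w w)) :=
        (isBoundedBilinearMap_apply (𝕜 := ℝ).continuous.tendsto (dualityMap w, w)).comp
          (hJ.prodMk_nhds hw1)
      have h := ((hw1.norm.pow 2).sub (hJx.const_mul 2)).add (hw.norm.pow 2)
      have h0 : ‖w‖ ^ 2 - 2 * dualityMap w w + ‖w‖ ^ 2 = 0 := phi_self w
      rwa [h0] at h
  have hgap : Tendsto (fun n => phi p (x n) - phi p (u n)) atTop (𝓝 0) := by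
    simpa using (hE.tendsto_phi_right p hw).sub (hE.tendsto_phi_right p hu)
  have hy : Tendsto y atTop (𝓝 w) :=
    tendsto_of_tendsto_phi hu (squeeze_zero (fun n => phi_nonneg _ _) (fun n => by
      linarith [hstep p hp n (hxC n) 0,
        mul_nonneg (ha_nonneg n 1) (phi_nonneg (y n) (z n 0))]) hgap)
  have hz : ∀ i, Tendsto (fun n => z n i) atTop (𝓝 w) := by
    intro i
    obtain ⟨c, hc, hac⟩ := exists_pos_eventually_le_of_liminf (ha_liminf i)
    refine tendsto_of_tendsto_phi hy (squeeze_zero' (Eventually.of_forall fun n => phi_nonneg _ _)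
      ?_ (g := fun n => (phi p (x n) - phi p (u n)) / c) (by simpa using hgap.div_const c))
    filter_upwards [hac] with n hn
    have ha0 : a n 0 ≤ 1 := le_hasSum (ha_sum n) 0 fun i _ => ha_nonneg n i
    have hca : c ≤ a n (i + 1) := hn.trans (mul_le_of_le_one_left (ha_nonneg n _) ha0)
    rw [le_div_iff₀ hc, mul_comm]
    have := mul_le_mul_of_nonneg_right hca (phi_nonneg (y n) (z n i))
    linarith [hstep p hp n (hxC n) i, phi_nonneg (u n) (y n)]
  have hwT : ∀ i, w ∈ fixedPoints C (T i) := by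
    refine fun i => ⟨hwC, (hT_closed i x w hxC hw ?_).1⟩
    refine squeeze_zero (fun n => Metric.infDist_nonneg)
      (fun n => Metric.infDist_le_dist_of_mem (hscheme.z_mem n i)) ?_
    simpa using hw.dist (hz i)
  have hwEP : w ∈ equilibriumSet C F := by
    obtain ⟨c, hc, hrc⟩ := exists_pos_eventually_le_of_liminf hr_liminf
    have hg : Tendsto (fun n => dualityMap (u n) - dualityMap (y n)) atTop (𝓝 0) := by
      simpa using (hE.tendsto_dualityMap hu).sub (hE.tendsto_dualityMap hy)
    exact hF.mem_equilibriumSet_of_tendsto hC_convex hwC hscheme.u_mem hu hg hr_pos hc hrc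
      hscheme.u_resolvent
  have hwS : w ∈ S := hS ▸ ⟨Set.mem_iInter.2 hwT, hwEP⟩
  have hwle : ∀ q, (∀ n, q ∈ K n) → phi w x₀ ≤ phi q x₀ := fun q hq =>
    le_of_tendsto' (((continuous_phi_left x₀).tendsto w).comp hw) fun n => (hproj n).2 q (hq n)
  have hwmin : IsGenProj S x₀ w := ⟨hwS, fun q hq => hwle q fun n => hSK n hq⟩
  -- uniqueness is inherited from the convex set `⋂ n, K n`, which contains `S`
  have huniq : ∀ q, IsGenProj S x₀ q → q = w := by
    intro q hq
    refine IsGenProj.eq (K := ⋂ n, K n) (convex_iInter fun n => (hinv n).2.1)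
      ⟨Set.mem_iInter.2 fun n => hSK n hq.1, fun v hv => ?_⟩
      ⟨Set.mem_iInter.2 fun n => hSK n hwS, fun v hv => hwle v (Set.mem_iInter.1 hv)⟩
    exact (hq.2 w hwS).trans (hwle v (Set.mem_iInter.1 hv))
  refine ⟨⟨w, hwmin, huniq⟩, ?_⟩
  have hex : ∃ q, IsGenProj S x₀ q := ⟨w, hwmin⟩
  rw [genProj, dif_pos hex, huniq _ hex.choose_spec]
  exact hw
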